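/- Let $m\ge 1$. A *lattice path* is a nearest-neighbour path in $\mathbb Z^2$ (steps $(\pm1,0)$, $(0,\pm1)$), which may repeat vertices and edges. Let $\Gamma$ be a region in the strip $0\le x\le m$ whose boundary consists of a vertical interval $\alpha\subset\{x=0\}$, a vertical interval $\beta\subset\{x=m\}$, and two $x$-monotone lattice paths $\eta_-,\eta_+$ (steps $(1,0)$, $(0,\pm1)$) which go from the bottom, respectively the top, end point of $\alpha$ to the bottom, respectively the top, end point of $\beta$, with $\eta_-$ weakly below $\eta_+$: over each interval $[i,i+1]$, the horizontal edge of $\eta_-$ is not above that of $\eta_+$. Thus $\Gamma$ is the set of points $(x,y)$ such that $(x,y_1)\in\eta_-$ and $(x,y_2)\in\eta_+$ for some $y_1\le y\le y_2$. A lattice path lies inside $\Gamma$ if all its vertices and edges do. Let $a,b,c,d,r$ be integers with $r>0$, and let $$A=(0,a),\quad B=(0,b),\quad C=(m,c),\quad C'=(m,c-r),\quad D'=(m,d+r),\quad D=(m,d),$$ where $A,B\in\alpha$ and $C,C',D',D\in\beta$. Suppose that $d\le c-r$ (that is, $C'$ is not below $D$) and $a-b\le (c-d)-r$. Then there is an injection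 $$\Phi:\ \{(\xi_{AC},\xi_{BD})\}\longrightarrow\{(\xi_{AC'},\xi_{BD'})\},$$ where $\xi_{PQ}$ ranges over the lattice paths from $P$ to $Q$ which lie inside $\Gamma$, such that, whenever $\Phi(\xi_{AC},\xi_{BD})=(\xi_{AC'},\xi_{BD'})$ and edges are counted with multiplicity: - for all $0\le i\le m-1$, the total number of horizontal edges of $\xi_{AC}$ and $\xi_{BD}$ which project vertically onto $[i,i+1]$ is equal to the total number of such edges of $\xi_{AC'}$ and $\xi_{BD'}$; - for all $0\le j\le m$, the total number of vertical edges of $\xi_{AC}$ and $\xi_{BD}$ which lie on the line $x=j$ is equal to the total number of such edges of $\xi_{AC'}$ and $\xi_{BD'}$. -/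

import Mathlib

/-- The nearest-neighbour graph on `ℤ²`. -/
def latticeGraph : SimpleGraph (ℤ × ℤ) where
  Adj p q := (p.1 = q.1 ∧ |p.2 - q.2| = 1) ∨ (p.2 = q.2 ∧ |p.1 - q.1| = 1)
  symm := ⟨fun p q h => by
    rcases h with ⟨h, k⟩ | ⟨h, k⟩
    · exact Or.inl ⟨h.symm, by rwa [abs_sub_comm]⟩
    · exact Or.inr ⟨h.symm, by rwa [abs_sub_comm]⟩⟩
  loopless := ⟨fun p h => by simp at h⟩

/-- A lattice path from `p` to `q`; vertices and edges may be repeated. -/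
abbrev LatticePath (p q : ℤ × ℤ) : Type := latticeGraph.Walk p q

namespace LatticePath

variable {p q : ℤ × ℤ}

/-- No step goes to the left: all steps are `(1,0)`, `(0,1)` or `(0,-1)`. -/
def XMonotone (w : LatticePath p q) : Prop :=
  ∀ e ∈ w.darts, e.fst.1 ≤ e.snd.1

/-- `w` traverses (in some direction) the horizontal unit edge joining `(i,y)` and `(i+1,y)`. -/
def UsesHorizontal (w : LatticePath p q) (i y : ℤ) : Prop :=
  s(((i, y) : ℤ × ℤ), ((i + 1, y) : ℤ × ℤ)) ∈ w.edges

/-- The number of horizontal edges of `w` (with multiplicity, in both directions) whose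
projection to the `x`-axis is `[i,i+1]`. -/
def horizontalCount (w : LatticePath p q) (i : ℤ) : ℕ :=
  w.darts.countP fun e =>
    decide ((e.fst.1 = i ∧ e.snd.1 = i + 1) ∨ (e.fst.1 = i + 1 ∧ e.snd.1 = i))

/-- The number of vertical edges of `w` (with multiplicity, in both directions) whose
projection to the `x`-axis is the point `j`. -/
def verticalCount (w : LatticePath p q) (j : ℤ) : ℕ :=
  w.darts.countP fun e => decide (e.fst.1 = j ∧ e.snd.1 = j)

end LatticePath

/-- A region of the strip `0 ≤ x ≤ m` bounded by a vertical interval on `x = 0`, a vertical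
interval on `x = m`, and two `x`-monotone lattice paths, `lower` lying (weakly) below `upper`.
The vertical intervals join the initial, respectively the final, points of the two paths.
The region is the set of points of the plane lying between the two paths, that is, the points
`(x,y)` such that `(x,y₁)` is on `lower` and `(x,y₂)` is on `upper` for some `y₁ ≤ y ≤ y₂`.
The two paths may touch each other. -/
structure LatticeRegion (m : ℕ) where
  leftBot : ℤ
  leftTop : ℤ
  rightBot : ℤ
  rightTop : ℤ
  left_le : leftBot ≤ leftTop
  right_le : rightBot ≤ rightTop
  /-- the lower boundary path -/
  lower : LatticePath ((0 : ℤ), leftBot) ((m : ℤ), rightBot)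
  /-- the upper boundary path -/
  upper : LatticePath ((0 : ℤ), leftTop) ((m : ℤ), rightTop)
  lower_mono : lower.XMonotone
  upper_mono : upper.XMonotone
  /-- over each `[i,i+1]`, the edge of `lower` is not above the edge of `upper` -/
  lower_le_upper : ∀ i y₁ y₂ : ℤ,
    lower.UsesHorizontal i y₁ → upper.UsesHorizontal i y₂ → y₁ ≤ y₂

namespace LatticeRegion

variable {m : ℕ}

/-- The vertical boundary interval on the line `x = 0`. -/
def α (Γ : LatticeRegion m) : Set (ℤ × ℤ) :=
  {p | p.1 = 0 ∧ Γ.leftBot ≤ p.2 ∧ p.2 ≤ Γ.leftTop}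

/-- The vertical boundary interval on the line `x = m`. -/
def β (Γ : LatticeRegion m) : Set (ℤ × ℤ) :=
  {p | p.1 = (m : ℤ) ∧ Γ.rightBot ≤ p.2 ∧ p.2 ≤ Γ.rightTop}

/-- The lattice points of the region (boundary included). -/
def ContainsPoint (Γ : LatticeRegion m) (p : ℤ × ℤ) : Prop :=
  ∃ y₁ y₂ : ℤ, y₁ ≤ p.2 ∧ p.2 ≤ y₂ ∧
    (p.1, y₁) ∈ Γ.lower.support ∧ (p.1, y₂) ∈ Γ.upper.support

/-- The horizontal unit edge from `(i,y)` to `(i+1,y)` lies in the region (boundary included). -/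
def ContainsHorizontal (Γ : LatticeRegion m) (i y : ℤ) : Prop :=
  ∃ y₁ y₂ : ℤ, y₁ ≤ y ∧ y ≤ y₂ ∧
    Γ.lower.UsesHorizontal i y₁ ∧ Γ.upper.UsesHorizontal i y₂

/-- The lattice path `w`, as a union of vertices and unit edges, lies inside the region.
As each vertical line meets the region in an interval, a vertical edge lies in the region
as soon as its two end points do. -/
def Inside (Γ : LatticeRegion m) {p q : ℤ × ℤ} (w : LatticePath p q) : Prop :=
  (∀ v ∈ w.support, Γ.ContainsPoint v) ∧
    ∀ i y : ℤ, w.UsesHorizontal i y → Γ.ContainsHorizontal i y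

/-- The lattice paths from `p` to `q` which lie inside `Γ`. -/
abbrev PathIn (Γ : LatticeRegion m) (p q : ℤ × ℤ) : Type :=
  {w : LatticePath p q // Γ.Inside w}

end LatticeRegion

/-!
Translate the path from `B` to `D` upwards by `s = (c - d) - r ≥ 0`. It then starts at
`(0, b + s)`, which is not below `A`, and ends at `C'`, which is below `C`. So it must meet the path
from `A` to `C`, and exchanging the two tails behind a common vertex and translating back gives
paths from `A` to `C'` and from `B` to `D'`. Tail exchange preserves the multiset of edges of the
pair, and the counts are invariant under vertical translations.

Two points need care. First, the exchanged tails have to stay in the region: they must lie both in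
`Γ` and in its translate `Γ + s`. Therefore the exchange only takes place in the maximal tails of
the two walks whose edges lie in both (`exists_maximal_tail`, `maximal_tail_unique`). If the tail of
the first walk is not the whole walk, the edge preceding it leaves `Γ + s`, and it can do so only
through the lower boundary (`LatticeRegion.above_of_not_step`); likewise the tail of the second walk
is preceded by an edge above the upper boundary of `Γ` (`LatticeRegion.below_of_not_step`). So the
two tails still start in the order opposite to the order of their ends, and they cross
(`LatticeRegion.exists_mem_loopErase`).

Second, the walks may intersect themselves, so a canonical common vertex has to be recovered from
the pair after the exchange. As in Fomin's identity, it is the last vertex of the loop erasure of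
one tail that lies on the other tail, and both tails are cut at their first visit to it. The
conditions that describe this cut are symmetric in the two initial parts, which makes the exchange
injective (`TailSwap.injective`).

The crossing lemma (`exists_common_vertex_of_ends`) is a parity argument. For a vertex `v` off the
first walk, count the steps of the first walk which pass below `v` over the unit interval to the
right of `v`, and add one if `v` is not to the left of the start of the first walk. Modulo two this
does not change along the second walk, but takes different values at its two ends. It is applied on
the lattice refined by a factor two, where the half edges preceding the tails become steps.
-/

/-! ### Lists of vertices: pair sums, maximal tails, cuts -/

section Lists

variable {V : Type*}

/-- The sum of `f u v` over the pairs `(u, v)` of consecutive entries of a list. -/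
def pairSum {M : Type*} [AddCommMonoid M] (f : V → V → M) : List V → M
  | [] => 0
  | [_] => 0
  | u :: v :: l => f u v + pairSum f (v :: l)

theorem pairSum_append_cons {M : Type*} [AddCommMonoid M] (f : V → V → M) (K : List V) (x : V)
    (l : List V) : pairSum f (K ++ x :: l) = pairSum f (K ++ [x]) + pairSum f (x :: l) := by
  induction K with
  | nil => simp [pairSum]
  | cons u K ih =>
    cases K with
    | nil => simp [pairSum]
    | cons v K =>
      simp only [List.cons_append, pairSum] at ih ⊢
      rw [ih, add_assoc]

theorem pairSum_map {W M : Type*} [AddCommMonoid M] (f : V → V → M) (g : W → V) :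
    ∀ l : List W, pairSum f (l.map g) = pairSum (fun u v => f (g u) (g v)) l
  | [] => rfl
  | [_] => rfl
  | u :: v :: l => by
    have := pairSum_map f g (v :: l)
    simp only [List.map_cons, pairSum] at this ⊢
    rw [this]

theorem pairSum_congr {M : Type*} [AddCommMonoid M] {f g : V → V → M} {r : V → V → Prop} :
    ∀ {l : List V}, l.IsChain r → (∀ u ∈ l, ∀ v ∈ l, r u v → f u v = g u v) →
      pairSum f l = pairSum g l
  | [], _, _ => rfl
  | [_], _, _ => rfl
  | u :: v :: l, h, H => by
    rw [List.isChain_cons_cons] at h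
    simp only [pairSum]
    rw [H u (by simp) v (by simp) h.1,
      pairSum_congr h.2 fun a ha b hb => H a (List.mem_cons_of_mem _ ha) b
        (List.mem_cons_of_mem _ hb)]

theorem pairSum_add {M : Type*} [AddCommMonoid M] (f g : V → V → M) :
    ∀ l : List V, pairSum (fun u v => f u v + g u v) l = pairSum f l + pairSum g l
  | [] => by simp [pairSum]
  | [_] => by simp [pairSum]
  | u :: v :: l => by
    simp only [pairSum]
    rw [pairSum_add f g (v :: l), add_add_add_comm]

theorem pairSum_zero {M : Type*} [AddCommMonoid M] :
    ∀ l : List V, pairSum (fun _ _ => (0 : M)) l = 0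
  | [] => rfl
  | [_] => rfl
  | u :: v :: l => by
    simp only [pairSum]
    rw [pairSum_zero (v :: l), add_zero]

/-- Modulo two, a sum of coboundaries along a walk only sees the end points. -/
theorem pairSum_coboundary (g : V → ZMod 2) :
    ∀ (l : List V) (u v : V), l.head? = some u → l.getLast? = some v →
      pairSum (fun a b => g a + g b) l = g u + g v
  | [], _, _, h, _ => by simp at h
  | [w], u, v, h, k => by
    simp only [List.head?_cons, Option.some.injEq, List.getLast?_singleton] at h k
    subst h k
    simp only [pairSum]
    exact (CharTwo.add_self_eq_zero _).symm
  | w :: w' :: l, u, v, h, k => by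
    simp only [List.head?_cons, Option.some.injEq] at h
    subst h
    rw [List.getLast?_cons_cons] at k
    simp only [pairSum]
    rw [pairSum_coboundary g (w' :: l) w' v rfl k]
    linear_combination CharTwo.add_self_eq_zero (g w')

/-- Every nonempty list has a longest nonempty final segment which is an `r`-chain; maximality is
expressed by the failure of `r` between the last entry before the segment and its first entry. -/
theorem exists_maximal_tail (r : V → V → Prop) (l : List V) (hl : l ≠ []) :
    ∃ K T, l = K ++ T ∧ T ≠ [] ∧ T.IsChain r ∧ ∀ g ∈ K.getLast?, ∀ h ∈ T.head?, ¬ r g h := by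
  induction l with
  | nil => exact absurd rfl hl
  | cons v t ih =>
    by_cases hc : (v :: t).IsChain r
    · exact ⟨[], v :: t, rfl, hl, hc, by simp⟩
    · have ht : t ≠ [] := by
        rintro rfl
        simp at hc
      obtain ⟨K, T, rfl, hT, hch, hmax⟩ := ih ht
      refine ⟨v :: K, T, rfl, hT, hch, ?_⟩
      rcases List.eq_nil_or_concat' K with rfl | ⟨K, k, rfl⟩
      · intro g hg h hh hr
        simp only [List.getLast?_singleton, Option.mem_some_iff] at hg
        subst hg
        obtain ⟨y, T, rfl⟩ := List.exists_cons_of_ne_nil hT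
        simp only [List.head?_cons, Option.mem_some_iff] at hh
        subst hh
        exact hc (List.isChain_cons_cons.2 ⟨hr, hch⟩)
      · rw [← List.cons_append, List.getLast?_concat]
        rwa [List.getLast?_concat] at hmax

theorem maximal_tail_prefix {r : V → V → Prop} {K T K' T' : List V} (h : K ++ T = K' ++ T')
    (hne : T' ≠ []) (hT : T.IsChain r) (hmax : ∀ g ∈ K'.getLast?, ∀ h ∈ T'.head?, ¬ r g h)
    {a : List V} (ha : K' = K ++ a) : K = K' := by
  subst ha
  rw [List.append_assoc, List.append_cancel_left_eq] at h
  subst h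
  rcases List.eq_nil_or_concat' a with rfl | ⟨a, k, rfl⟩
  · simp
  · obtain ⟨y, T', rfl⟩ := List.exists_cons_of_ne_nil hne
    rw [← List.append_assoc, List.getLast?_concat] at hmax
    exact absurd ((List.isChain_append.1 hT).2.2 k (by simp) y (by simp))
      (hmax k rfl y rfl)

/-- A list has only one decomposition whose second part is a maximal tail. -/
theorem maximal_tail_unique {r : V → V → Prop} {K T K' T' : List V} (h : K ++ T = K' ++ T')
    (hT : T.IsChain r) (hT' : T'.IsChain r) (hne : T ≠ []) (hne' : T' ≠ [])
    (hmax : ∀ g ∈ K.getLast?, ∀ h ∈ T.head?, ¬ r g h)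
    (hmax' : ∀ g ∈ K'.getLast?, ∀ h ∈ T'.head?, ¬ r g h) : K = K' ∧ T = T' := by
  have hK : K = K' := by
    rcases List.append_eq_append_iff.1 h with ⟨a, ha, -⟩ | ⟨a, ha, -⟩
    · exact maximal_tail_prefix h hne' hT hmax' ha
    · exact (maximal_tail_prefix h.symm hne hT' hmax ha).symm
  subst hK
  exact ⟨rfl, List.append_cancel_left h⟩

theorem cut_unique {x : V} {Q P Q' P' : List V} (h : Q ++ x :: P = Q' ++ x :: P')
    (hQ : x ∉ Q) (hQ' : x ∉ Q') : Q = Q' ∧ P = P' := by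
  rcases List.append_eq_append_iff.1 h with ⟨a, rfl, h2⟩ | ⟨a, rfl, h2⟩ <;>
  · cases a with
    | nil => simp_all
    | cons y a =>
      simp only [List.cons_append, List.cons.injEq] at h2
      simp_all

/-- If `x, x'` lie in `S` and nothing behind them does, the two cuts agree. -/
theorem last_cut_unique {S : V → Prop} {x x' : V} {G E G' E' : List V}
    (h : G ++ x :: E = G' ++ x' :: E') (hx : S x) (hx' : S x')
    (hE : ∀ e ∈ E, ¬ S e) (hE' : ∀ e ∈ E', ¬ S e) : x = x' ∧ E = E' := by
  rcases List.append_eq_append_iff.1 h with ⟨a, rfl, h2⟩ | ⟨a, rfl, h2⟩ <;>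
  · cases a with
    | nil => simp_all
    | cons y a =>
      simp only [List.cons_append, List.cons.injEq] at h2
      obtain ⟨rfl, rfl⟩ := h2
      simp_all

theorem exists_last_cut {S : V → Prop} :
    ∀ {l : List V}, (∃ x ∈ l, S x) → ∃ G x E, l = G ++ x :: E ∧ S x ∧ ∀ e ∈ E, ¬ S e
  | [], h => by simp at h
  | v :: t, h => by
    by_cases ht : ∃ x ∈ t, S x
    · obtain ⟨G, x, E, rfl, hx, hE⟩ := exists_last_cut ht
      exact ⟨v :: G, x, E, rfl, hx, hE⟩
    · push Not at ht
      obtain ⟨x, hx, hS⟩ := h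
      rcases List.mem_cons.1 hx with rfl | hx
      · exact ⟨[], x, t, rfl, hS, ht⟩
      · exact absurd hS (ht x hx)

theorem head?_append_cons (Q P : List V) (x : V) :
    (Q ++ x :: P).head? = (Q ++ [x]).head? := by
  cases Q <;> rfl

/-! ### Loop erasure and the exchange of tails -/

section LoopErase

variable [DecidableEq V]

/-- The loop erasure of a list of vertices, the loops being erased in the order in which they
are closed when the list is read from its end. -/
def loopErase : List V → List V
  | [] => []
  | v :: t => if v ∈ loopErase t then (loopErase t).dropWhile (fun w => decide (w ≠ v))
      else v :: loopErase t

theorem dropWhile_ne_of_mem {v : V} : ∀ {l : List V}, v ∈ l →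
    ∃ G E, l = G ++ v :: E ∧ l.dropWhile (fun w => decide (w ≠ v)) = v :: E
  | [], h => by simp at h
  | w :: l, h => by
    by_cases hw : w = v
    · subst hw
      exact ⟨[], l, rfl, by simp⟩
    · obtain ⟨G, E, hl, hd⟩ := dropWhile_ne_of_mem (l := l) (by
        rcases List.mem_cons.1 h with h | h
        · exact absurd h.symm hw
        · exact h)
      refine ⟨w :: G, E, by rw [hl]; rfl, ?_⟩
      rw [List.dropWhile_cons_of_pos (by simpa using hw), hd]

/-- The recursion for `loopErase` without `dropWhile`: prepending `v` keeps the old loop erasure or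
cuts it back to its occurrence of `v`. -/
theorem loopErase_cons (v : V) (t : List V) :
    ∃ E, loopErase (v :: t) = v :: E ∧
      ((v ∉ loopErase t ∧ E = loopErase t) ∨ ∃ G, loopErase t = G ++ v :: E) := by
  by_cases h : v ∈ loopErase t
  · obtain ⟨G, E, hl, hd⟩ := dropWhile_ne_of_mem h
    exact ⟨E, by rw [loopErase, if_pos h, hd], Or.inr ⟨G, hl⟩⟩
  · exact ⟨_, by rw [loopErase, if_neg h], Or.inl ⟨h, rfl⟩⟩

theorem nodup_loopErase : ∀ l : List V, (loopErase l).Nodup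
  | [] => by simp [loopErase]
  | v :: t => by
    have ih := nodup_loopErase t
    obtain ⟨E, h, ⟨h1, h2⟩ | ⟨G, h1⟩⟩ := loopErase_cons v t
    · rw [h, h2]
      exact List.nodup_cons.2 ⟨h1, ih⟩
    · rw [h]
      rw [h1] at ih
      exact (List.nodup_append.1 ih).2.1

theorem isChain_loopErase {r : V → V → Prop} :
    ∀ l : List V, l.IsChain r → (loopErase l).IsChain r
  | [], _ => by simp [loopErase]
  | [v], _ => by simp [loopErase]
  | v :: w :: t, hl => by
    rw [List.isChain_cons_cons] at hl
    have ih := isChain_loopErase (w :: t) hl.2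
    obtain ⟨E', h', -⟩ := loopErase_cons w t
    obtain ⟨E, h, ⟨h1, h2⟩ | ⟨G, h1⟩⟩ := loopErase_cons v (w :: t)
    · rw [h, h2, h', List.isChain_cons_cons, ← h']
      exact ⟨hl.1, ih⟩
    · rw [h]
      rw [h1] at ih
      exact (List.isChain_append.1 ih).2.1

theorem loopErase_subset : ∀ (l : List V), ∀ x ∈ loopErase l, x ∈ l
  | [], x, hx => by simp [loopErase] at hx
  | v :: t, x, hx => by
    obtain ⟨E, h, ⟨h1, h2⟩ | ⟨G, h1⟩⟩ := loopErase_cons v t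
    · rw [h, h2] at hx
      rcases List.mem_cons.1 hx with rfl | hx
      · simp
      · exact List.mem_cons_of_mem _ (loopErase_subset t x hx)
    · rw [h] at hx
      exact List.mem_cons_of_mem _
        (loopErase_subset t x (h1 ▸ List.mem_append_right _ hx))

theorem head?_loopErase (l : List V) : (loopErase l).head? = l.head? := by
  cases l with
  | nil => rfl
  | cons v t =>
    obtain ⟨E, h, -⟩ := loopErase_cons v t
    rw [h]; rfl

theorem getLast?_loopErase : ∀ l : List V, (loopErase l).getLast? = l.getLast?
  | [] => rfl
  | [v] => by simp [loopErase]
  | v :: w :: t => by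
    have ih := getLast?_loopErase (w :: t)
    obtain ⟨E', h', -⟩ := loopErase_cons w t
    rw [List.getLast?_cons_cons, ← ih]
    obtain ⟨E, h, ⟨h1, h2⟩ | ⟨G, h1⟩⟩ := loopErase_cons v (w :: t)
    · rw [h, h2, h', List.getLast?_cons_cons]
    · rw [h, h1, List.getLast?_append_of_ne_nil _ (by simp)]

/-- A walk prepended to `l` which avoids the loop erasure of `l` leaves it intact. -/
theorem loopErase_append {l : List V} :
    ∀ {Q : List V}, (∀ x ∈ Q, x ∉ loopErase l) → ∃ G, loopErase (Q ++ l) = G ++ loopErase l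
  | [], _ => ⟨[], rfl⟩
  | v :: Q, hQ => by
    obtain ⟨G, hG⟩ := loopErase_append (Q := Q) fun x hx => hQ x (List.mem_cons_of_mem _ hx)
    obtain ⟨E, h, ⟨h1, h2⟩ | ⟨G', h1⟩⟩ := loopErase_cons v (Q ++ l)
    · exact ⟨v :: G, by rw [List.cons_append, h, h2, hG]; rfl⟩
    · rw [hG] at h1
      rcases List.append_eq_append_iff.1 h1 with ⟨a, -, h2⟩ | ⟨a, -, h2⟩
      · exact absurd (by rw [h2]; simp) (hQ v (by simp))
      · exact ⟨a, by rw [List.cons_append, h, h2]⟩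

/-- The converse of `loopErase_append`: if `x` is on the loop erasure, then what follows it there is
produced by the part of the walk behind its first visit to `x`, and the part before that visit
avoids it. -/
theorem loopErase_of_append {x : V} {P G E : List V} :
    ∀ {Q : List V}, loopErase (Q ++ x :: P) = G ++ x :: E → x ∉ Q →
      loopErase (x :: P) = x :: E ∧ ∀ y ∈ Q, y ∉ E
  | [], h, _ => by
    refine ⟨?_, by simp⟩
    rw [List.nil_append] at h
    obtain ⟨F, hF, -⟩ := loopErase_cons x P
    have hn := nodup_loopErase (x :: P)
    cases G with
    | nil => exact h
    | cons y G =>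
      rw [h] at hF hn
      simp only [List.cons_append, List.cons.injEq] at hF
      obtain ⟨rfl, -⟩ := hF
      simp at hn
  | q :: Q, h, hx => by
    have hn := nodup_loopErase (q :: Q ++ x :: P)
    rw [List.cons_append] at h hn
    simp only [List.mem_cons, not_or] at hx
    obtain ⟨F, hF, hor⟩ := loopErase_cons q (Q ++ x :: P)
    obtain ⟨G', rfl⟩ : ∃ G', G = q :: G' := by
      rw [hF] at h
      cases G with
      | nil =>
        simp only [List.nil_append, List.cons.injEq] at h
        exact absurd h.1.symm hx.1
      | cons y G =>
        simp only [List.cons_append, List.cons.injEq] at h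
        exact ⟨G, by rw [h.1]⟩
    have hqE : q ∉ E := by
      rw [h] at hn
      simp only [List.cons_append, List.nodup_cons, List.mem_append, List.mem_cons, not_or] at hn
      exact hn.1.2.2
    obtain ⟨G'', hG''⟩ : ∃ G'', loopErase (Q ++ x :: P) = G'' ++ x :: E := by
      rw [hF, List.cons_append, List.cons.injEq] at h
      rcases hor with ⟨-, h2⟩ | ⟨G0, h1⟩
      · exact ⟨G', by rw [← h2, h.2]⟩
      · exact ⟨G0 ++ q :: G', by rw [h1, h.2]; simp⟩
    obtain ⟨h1, h2⟩ := loopErase_of_append hG'' hx.2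
    refine ⟨h1, fun y hy => ?_⟩
    rcases List.mem_cons.1 hy with rfl | hy
    · exact hqE
    · exact h2 y hy

/-- The lists `l'₁, l'₂` arise from `l₁, l₂` by exchanging the tails behind a vertex `x`.
The vertex is visited by the maximal `r`-tails `Q ++ x :: P` and `U ++ x :: W` of `l₁` and `l₂`;
each tail is cut at its first visit to `x`, and `x` is the last vertex of the loop erasure of
`Q ++ x :: P` that lies on `U ++ x :: W`. The conditions are symmetric under exchanging `Q`
and `U`. -/
def TailSwap (r : V → V → Prop) (l₁ l₂ l'₁ l'₂ : List V) : Prop :=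
  ∃ (K₁ K₂ Q U P W E : List V) (x : V),
    l₁ = K₁ ++ (Q ++ x :: P) ∧ l₂ = K₂ ++ (U ++ x :: W) ∧
    l'₁ = K₁ ++ (Q ++ x :: W) ∧ l'₂ = K₂ ++ (U ++ x :: P) ∧
    (Q ++ x :: P).IsChain r ∧ (U ++ x :: W).IsChain r ∧
    (∀ g ∈ K₁.getLast?, ∀ h ∈ (Q ++ [x]).head?, ¬ r g h) ∧
    (∀ g ∈ K₂.getLast?, ∀ h ∈ (U ++ [x]).head?, ¬ r g h) ∧
    x ∉ Q ∧ x ∉ U ∧ loopErase (x :: P) = x :: E ∧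
    (∀ y ∈ Q, y ∉ E) ∧ (∀ y ∈ U, y ∉ E) ∧ (∀ y ∈ W, y ∉ E)

/-- The pair before the exchange is determined by the pair after it: the maximal tails keep their
starting points, so they can be recovered; then `x` is the last vertex of the loop erasure of
`U ++ x :: P` that lies on `Q ++ x :: W`, and both tails are cut at their first visit to `x`. -/
theorem TailSwap.injective {r : V → V → Prop} {l₁ l₂ m₁ m₂ l'₁ l'₂ : List V}
    (h : TailSwap r l₁ l₂ l'₁ l'₂) (k : TailSwap r m₁ m₂ l'₁ l'₂) : l₁ = m₁ ∧ l₂ = m₂ := by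
  obtain ⟨K₁, K₂, Q, U, P, W, E, x, rfl, rfl, rfl, rfl, hc₁, hc₂, hm₁, hm₂, hxQ, hxU, hE,
    hQ, hU, hW⟩ := h
  obtain ⟨J₁, J₂, Q', U', P', W', E', x', rfl, rfl, e₁, e₂, kc₁, kc₂, km₁, km₂, kxQ, kxU, kE,
    kQ, kU, kW⟩ := k
  rw [List.isChain_split] at hc₁ hc₂ kc₁ kc₂
  obtain ⟨rfl, f₁⟩ := maximal_tail_unique e₁ (List.isChain_split.2 ⟨hc₁.1, hc₂.2⟩)
    (List.isChain_split.2 ⟨kc₁.1, kc₂.2⟩) (by simp) (by simp)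
    (by rwa [head?_append_cons]) (by rwa [head?_append_cons])
  obtain ⟨rfl, f₂⟩ := maximal_tail_unique e₂ (List.isChain_split.2 ⟨hc₂.1, hc₁.2⟩)
    (List.isChain_split.2 ⟨kc₂.1, kc₁.2⟩) (by simp) (by simp)
    (by rwa [head?_append_cons]) (by rwa [head?_append_cons])
  have hxE : x ∉ E := by
    have := nodup_loopErase (x :: P)
    rw [hE] at this
    exact (List.nodup_cons.1 this).1
  have kxE : x' ∉ E' := by
    have := nodup_loopErase (x' :: P')
    rw [kE] at this
    exact (List.nodup_cons.1 this).1
  -- The tail `P`, which carries the loop erasure, now belongs to the second walk.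
  obtain ⟨G, hG⟩ := loopErase_append (l := x :: P) (Q := U) (by
    intro y hy
    rw [hE, List.mem_cons, not_or]
    exact ⟨fun h => hxU (h ▸ hy), hU y hy⟩)
  obtain ⟨G', hG'⟩ := loopErase_append (l := x' :: P') (Q := U') (by
    intro y hy
    rw [kE, List.mem_cons, not_or]
    exact ⟨fun h => kxU (h ▸ hy), kU y hy⟩)
  rw [hE] at hG
  rw [f₂, hG', kE] at hG
  obtain ⟨rfl, rfl⟩ := last_cut_unique (S := fun y => y ∈ Q ++ x :: W) hG
    (by rw [f₁]; simp) (by simp)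
    (by
      intro e he hS
      rw [f₁] at hS
      simp only [List.mem_append, List.mem_cons] at hS
      rcases hS with hS | rfl | hS
      · exact kQ e hS he
      · exact kxE he
      · exact kW e hS he)
    (by
      intro e he hS
      simp only [List.mem_append, List.mem_cons] at hS
      rcases hS with hS | rfl | hS
      · exact hQ e hS he
      · exact hxE he
      · exact hW e hS he)
  obtain ⟨rfl, rfl⟩ := cut_unique f₁ hxQ kxQ
  obtain ⟨rfl, rfl⟩ := cut_unique f₂ hxU kxU
  exact ⟨rfl, rfl⟩

theorem exists_tailSwap {r : V → V → Prop} {K₁ K₂ T₁ T₂ : List V}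
    (hT₁ : T₁.IsChain r) (hT₂ : T₂.IsChain r)
    (hm₁ : ∀ g ∈ K₁.getLast?, ∀ h ∈ T₁.head?, ¬ r g h)
    (hm₂ : ∀ g ∈ K₂.getLast?, ∀ h ∈ T₂.head?, ¬ r g h)
    (hx : ∃ x ∈ loopErase T₁, x ∈ T₂) :
    ∃ l'₁ l'₂, TailSwap r (K₁ ++ T₁) (K₂ ++ T₂) l'₁ l'₂ := by
  obtain ⟨G, x, E, hG, hxT, hE⟩ := exists_last_cut (S := fun y => y ∈ T₂) hx
  obtain ⟨Q, P, rfl, hxQ⟩ := List.eq_append_cons_of_mem (loopErase_subset T₁ x (by rw [hG]; simp))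
  obtain ⟨U, W, rfl, hxU⟩ := List.eq_append_cons_of_mem hxT
  obtain ⟨h1, h2⟩ := loopErase_of_append hG hxQ
  exact ⟨_, _, K₁, K₂, Q, U, P, W, E, x, rfl, rfl, rfl, rfl, hT₁, hT₂,
    by rwa [head?_append_cons] at hm₁, by rwa [head?_append_cons] at hm₂, hxQ, hxU, h1, h2,
    fun y hy he => hE y he (by simp [hy]), fun y hy he => hE y he (by simp [hy])⟩

theorem TailSwap.pairSum_add {r : V → V → Prop} {l₁ l₂ l'₁ l'₂ : List V}
    (h : TailSwap r l₁ l₂ l'₁ l'₂) {M : Type*} [AddCommMonoid M] (f : V → V → M) :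
    pairSum f l₁ + pairSum f l₂ = pairSum f l'₁ + pairSum f l'₂ := by
  obtain ⟨K₁, K₂, Q, U, P, W, E, x, rfl, rfl, rfl, rfl, -⟩ := h
  simp only [← List.append_assoc]
  rw [pairSum_append_cons f _ x P, pairSum_append_cons f _ x W,
    pairSum_append_cons f (K₁ ++ Q) x W, pairSum_append_cons f (K₂ ++ U) x P]
  abel

theorem TailSwap.isChain_left {r s : V → V → Prop} {l₁ l₂ l'₁ l'₂ : List V}
    (h : TailSwap r l₁ l₂ l'₁ l'₂) (hrs : ∀ u v, r u v → s u v) (hl : l₁.IsChain s) :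
    l'₁.IsChain s := by
  obtain ⟨K₁, K₂, Q, U, P, W, E, x, rfl, rfl, rfl, rfl, hc₁, hc₂, -⟩ := h
  rw [← List.append_assoc, List.isChain_split] at hl ⊢
  exact ⟨hl.1, (List.isChain_split.1 hc₂).2.imp hrs⟩

theorem TailSwap.isChain_right {r s : V → V → Prop} {l₁ l₂ l'₁ l'₂ : List V}
    (h : TailSwap r l₁ l₂ l'₁ l'₂) (hrs : ∀ u v, r u v → s u v) (hl : l₂.IsChain s) :
    l'₂.IsChain s := by
  obtain ⟨K₁, K₂, Q, U, P, W, E, x, rfl, rfl, rfl, rfl, hc₁, hc₂, -⟩ := h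
  rw [← List.append_assoc, List.isChain_split] at hl ⊢
  exact ⟨hl.1, (List.isChain_split.1 hc₁).2.imp hrs⟩

theorem TailSwap.ends {r : V → V → Prop} {l₁ l₂ l'₁ l'₂ : List V}
    (h : TailSwap r l₁ l₂ l'₁ l'₂) :
    l'₁.head? = l₁.head? ∧ l'₂.head? = l₂.head? ∧
      l'₁.getLast? = l₂.getLast? ∧ l'₂.getLast? = l₁.getLast? := by
  obtain ⟨K₁, K₂, Q, U, P, W, E, x, rfl, rfl, rfl, rfl, -⟩ := h
  simp only [← List.append_assoc]
  refine ⟨?_, ?_, ?_, ?_⟩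
  · rw [head?_append_cons, head?_append_cons _ P]
  · rw [head?_append_cons, head?_append_cons _ W]
  · rw [List.getLast?_append_of_ne_nil _ (by simp), List.getLast?_append_of_ne_nil _ (by simp)]
  · rw [List.getLast?_append_of_ne_nil _ (by simp), List.getLast?_append_of_ne_nil _ (by simp)]

end LoopErase

end Lists

/-! ### Crossing lattice walks -/

section Crossing

theorem eq_of_isChain_eq {V M : Type*} (F : V → M) :
    ∀ {l : List V} {u v : V}, l.IsChain (fun a b => F a = F b) → l.head? = some u →
      l.getLast? = some v → F u = F v
  | [], _, _, _, h, _ => by simp at h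
  | [w], u, v, _, h, k => by
    simp only [List.head?_cons, Option.some.injEq, List.getLast?_singleton] at h k
    rw [← h, ← k]
  | w :: w' :: l, u, v, hc, h, k => by
    rw [List.isChain_cons_cons] at hc
    simp only [List.head?_cons, Option.some.injEq] at h
    rw [List.getLast?_cons_cons] at k
    rw [← h, hc.1]
    exact eq_of_isChain_eq F hc.2 rfl k

theorem latticeGraph_adj_iff {u v : ℤ × ℤ} : latticeGraph.Adj u v ↔
    (v.1 = u.1 ∧ (v.2 = u.2 + 1 ∨ u.2 = v.2 + 1)) ∨
      (v.2 = u.2 ∧ (v.1 = u.1 + 1 ∨ u.1 = v.1 + 1)) := by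
  change ((u.1 = v.1 ∧ |u.2 - v.2| = 1) ∨ (u.2 = v.2 ∧ |u.1 - v.1| = 1)) ↔ _
  rw [abs_eq zero_le_one, abs_eq zero_le_one]
  omega

/-- Indicator, modulo two, of the steps that cross the column `[x, x + 1]` strictly below
height `y`. -/
def crossBelow (x y : ℤ) (u v : ℤ × ℤ) : ZMod 2 :=
  if ((u.1 = x ∧ v.1 = x + 1) ∨ (u.1 = x + 1 ∧ v.1 = x)) ∧ u.2 < y then 1 else 0

theorem pairSum_crossBelow_up {l : List (ℤ × ℤ)} (hl : l.IsChain latticeGraph.Adj) {x y : ℤ}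
    (h : (x, y) ∉ l) : pairSum (crossBelow x (y + 1)) l = pairSum (crossBelow x y) l := by
  refine pairSum_congr hl fun u hu v hv huv => ?_
  have hu' : ¬ (u.1 = x ∧ u.2 = y) := fun k => h (by rwa [← k.1, ← k.2])
  have hv' : ¬ (v.1 = x ∧ v.2 = y) := fun k => h (by rwa [← k.1, ← k.2])
  rw [latticeGraph_adj_iff] at huv
  simp only [crossBelow]
  refine if_congr ?_ rfl rfl
  omega

theorem pairSum_crossBelow_right {l : List (ℤ × ℤ)} (hl : l.IsChain latticeGraph.Adj) {x y : ℤ}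
    (h : (x + 1, y) ∉ l) {p p' : ℤ × ℤ} (hp : l.head? = some p) (hp' : l.getLast? = some p') :
    pairSum (crossBelow x y) l + pairSum (crossBelow (x + 1) y) l =
      (if p.1 = x + 1 ∧ p.2 < y then 1 else 0) + (if p'.1 = x + 1 ∧ p'.2 < y then 1 else 0) := by
  rw [← pairSum_coboundary (fun u => if u.1 = x + 1 ∧ u.2 < y then 1 else 0) l p p' hp hp',
    ← pairSum_add]
  refine pairSum_congr hl fun u hu v hv huv => ?_
  have hu' : ¬ (u.1 = x + 1 ∧ u.2 = y) := fun k => h (by rwa [← k.1, ← k.2])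
  have hv' : ¬ (v.1 = x + 1 ∧ v.2 = y) := fun k => h (by rwa [← k.1, ← k.2])
  rw [latticeGraph_adj_iff] at huv
  simp only [crossBelow]
  split_ifs <;> first | rfl | omega

/-- The first walk leads from `p` to `p'`, the second one from `q` to `q'`; the vertical rays going
down from `p` and up from `p'` avoid the second walk, and those going up from `q` and down from
`q'` avoid the first one. If `p` is not to the right
of `q'` and `q` is to the left of `p'`, then the walks have a common vertex. -/
theorem exists_common_vertex_of_ends {l₁ l₂ : List (ℤ × ℤ)}
    (h₁ : l₁.IsChain latticeGraph.Adj) (h₂ : l₂.IsChain latticeGraph.Adj) {p p' q q' : ℤ × ℤ}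
    (hp : l₁.head? = some p) (hp' : l₁.getLast? = some p')
    (hq : l₂.head? = some q) (hq' : l₂.getLast? = some q')
    (hpq : p.1 ≤ q'.1) (hqp : q.1 < p'.1)
    (hpl : ∀ v ∈ l₂, v.1 = p.1 → p.2 < v.2) (hpl' : ∀ v ∈ l₂, v.1 = p'.1 → v.2 < p'.2)
    (hql : ∀ u ∈ l₁, u.1 = q.1 → u.2 < q.2) (hql' : ∀ u ∈ l₁, u.1 = q'.1 → q'.2 < u.2) :
    ∃ u ∈ l₁, u ∈ l₂ := by
  by_contra! hd
  -- The second summand of `F` accounts for the ray going down from `p`.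
  set F : ℤ × ℤ → ZMod 2 := fun v =>
    pairSum (crossBelow v.1 v.2) l₁ + if p.1 ≤ v.1 then 1 else 0 with hF
  have hup : ∀ u ∈ l₂, ∀ v ∈ l₂, v.1 = u.1 → v.2 = u.2 + 1 → F u = F v := by
    intro u hu v hv e1 e2
    simp only [hF, e1, e2]
    rw [pairSum_crossBelow_up h₁ fun h => hd _ h hu]
  have hright : ∀ u ∈ l₂, ∀ v ∈ l₂, v.2 = u.2 → v.1 = u.1 + 1 → F u = F v := by
    intro u hu v hv e1 e2
    have hv1 : (u.1 + 1, u.2) ∉ l₁ := fun h => hd _ h (by rwa [← e1, ← e2])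
    have key := pairSum_crossBelow_right h₁ hv1 hp hp'
    simp only [hF, e1, e2]
    have a1 := hpl v hv
    have a2 := hpl' v hv
    rw [if_neg (by omega : ¬ (p'.1 = u.1 + 1 ∧ p'.2 < u.2)), add_zero] at key
    have e : (if p.1 ≤ u.1 + 1 then 1 else 0 : ZMod 2) =
        (if p.1 ≤ u.1 then 1 else 0) + if p.1 = u.1 + 1 ∧ p.2 < u.2 then 1 else 0 := by
      split_ifs <;> first | rfl | omega
    rw [e, ← key]
    linear_combination -CharTwo.add_self_eq_zero (pairSum (crossBelow (u.1 + 1) u.2) l₁)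
  have hch : l₂.IsChain (fun a b => F a = F b) := by
    refine h₂.imp_of_mem_imp fun u v hu hv huv => ?_
    rcases latticeGraph_adj_iff.1 huv with ⟨e, e' | e'⟩ | ⟨e, e' | e'⟩
    · exact hup u hu v hv e e'
    · exact (hup v hv u hu e.symm e').symm
    · exact hright u hu v hv e e'
    · exact (hright v hv u hu e.symm e').symm
  have hend := eq_of_isChain_eq F hch hq hq'
  have hq'0 : pairSum (crossBelow q'.1 q'.2) l₁ = 0 := by
    rw [← pairSum_zero l₁]
    refine pairSum_congr h₁ fun u hu v hv huv => ?_
    have a1 := hql' u hu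
    have a2 := hql' v hv
    rw [latticeGraph_adj_iff] at huv
    rw [crossBelow, if_neg (by omega)]
  have hq0 : pairSum (crossBelow q.1 q.2) l₁ = if p.1 ≤ q.1 then 1 else 0 := by
    have e := pairSum_coboundary (fun u => if u.1 ≤ q.1 then 1 else 0) l₁ p p' hp hp'
    rw [if_neg (by omega : ¬ p'.1 ≤ q.1), add_zero] at e
    rw [← e]
    refine pairSum_congr h₁ fun u hu v hv huv => ?_
    have a1 := hql u hu
    have a2 := hql v hv
    rw [latticeGraph_adj_iff] at huv
    simp only [crossBelow]
    split_ifs <;> first | rfl | omega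
  simp only [hF] at hend
  rw [hq'0, hq0, if_pos hpq, CharTwo.add_self_eq_zero, zero_add] at hend
  exact zero_ne_one hend

/-- The list of doubled vertices and doubled edge midpoints met by a walk. -/
def subdivide : List (ℤ × ℤ) → List (ℤ × ℤ)
  | [] => []
  | [v] => [v + v]
  | v :: w :: l => (v + v) :: (v + w) :: subdivide (w :: l)

theorem subdivide_cons (v : ℤ × ℤ) (l : List (ℤ × ℤ)) :
    ∃ l', subdivide (v :: l) = (v + v) :: l' := by
  cases l <;> exact ⟨_, rfl⟩

theorem head?_subdivide {l : List (ℤ × ℤ)} {u : ℤ × ℤ} (h : l.head? = some u) :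
    (subdivide l).head? = some (u + u) := by
  cases l with
  | nil => simp at h
  | cons v l =>
    simp only [List.head?_cons, Option.some.injEq] at h
    obtain ⟨l', hl'⟩ := subdivide_cons v l
    rw [hl', h]; rfl

theorem getLast?_subdivide : ∀ {l : List (ℤ × ℤ)} {u : ℤ × ℤ}, l.getLast? = some u →
    (subdivide l).getLast? = some (u + u)
  | [], _, h => by simp at h
  | [v], u, h => by
    simp only [List.getLast?_singleton, Option.some.injEq] at h
    simp [subdivide, h]
  | v :: w :: l, u, h => by
    rw [List.getLast?_cons_cons] at h
    have ih := getLast?_subdivide h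
    obtain ⟨l', hl'⟩ := subdivide_cons w l
    rw [subdivide, hl', List.getLast?_cons_cons, List.getLast?_cons_cons, ← hl', ih]

theorem adj_midpoint_right {v w : ℤ × ℤ} (h : latticeGraph.Adj v w) :
    latticeGraph.Adj (v + w) (w + w) := by
  rw [latticeGraph_adj_iff] at h ⊢
  simp only [Prod.fst_add, Prod.snd_add]
  omega

theorem adj_midpoint_left {v w : ℤ × ℤ} (h : latticeGraph.Adj v w) :
    latticeGraph.Adj (v + v) (v + w) := by
  rw [latticeGraph_adj_iff] at h ⊢
  simp only [Prod.fst_add, Prod.snd_add]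
  omega

theorem isChain_subdivide : ∀ {l : List (ℤ × ℤ)}, l.IsChain latticeGraph.Adj →
    (subdivide l).IsChain latticeGraph.Adj
  | [], _ => by simp [subdivide]
  | [v], _ => by simp [subdivide]
  | v :: w :: l, h => by
    rw [List.isChain_cons_cons] at h
    have ih := isChain_subdivide h.2
    obtain ⟨l', hl'⟩ := subdivide_cons w l
    rw [subdivide]
    rw [hl'] at ih ⊢
    rw [List.isChain_cons_cons, List.isChain_cons_cons]
    exact ⟨adj_midpoint_left h.1, adj_midpoint_right h.1, ih⟩

theorem mem_subdivide {r : ℤ × ℤ → ℤ × ℤ → Prop} : ∀ {l : List (ℤ × ℤ)}, l.IsChain r →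
    ∀ {u : ℤ × ℤ}, u ∈ subdivide l →
      (∃ v ∈ l, u = v + v) ∨ ∃ v ∈ l, ∃ w ∈ l, r v w ∧ u = v + w
  | [], _, u, hu => by simp [subdivide] at hu
  | [v], _, u, hu => by
    simp only [subdivide, List.mem_singleton] at hu
    exact Or.inl ⟨v, by simp, hu⟩
  | v :: w :: l, h, u, hu => by
    rw [List.isChain_cons_cons] at h
    rw [subdivide, List.mem_cons, List.mem_cons] at hu
    rcases hu with rfl | rfl | hu
    · exact Or.inl ⟨v, by simp, rfl⟩
    · exact Or.inr ⟨v, by simp, w, by simp, h.1, rfl⟩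
    · rcases mem_subdivide h.2 hu with ⟨a, ha, rfl⟩ | ⟨a, ha, b, hb, hab, rfl⟩
      · exact Or.inl ⟨a, List.mem_cons_of_mem _ ha, rfl⟩
      · exact Or.inr ⟨a, List.mem_cons_of_mem _ ha, b, List.mem_cons_of_mem _ hb, hab, rfl⟩

/-- Subdivided walks can only meet at doubled vertices and at midpoints of common edges. -/
theorem exists_common_vertex_of_subdivide {l₁ l₂ : List (ℤ × ℤ)}
    (h₁ : l₁.IsChain latticeGraph.Adj) (h₂ : l₂.IsChain latticeGraph.Adj)
    (h : ∃ u ∈ subdivide l₁, u ∈ subdivide l₂) : ∃ u ∈ l₁, u ∈ l₂ := by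
  obtain ⟨u, hu₁, hu₂⟩ := h
  rcases mem_subdivide h₁ hu₁ with ⟨v, hv, rfl⟩ | ⟨v, hv, w, hw, hvw, rfl⟩ <;>
    rcases mem_subdivide h₂ hu₂ with ⟨a, ha, e⟩ | ⟨a, ha, b, hb, hab, e⟩ <;>
    simp only [Prod.ext_iff, Prod.fst_add, Prod.snd_add] at e
  · have : v = a := Prod.ext (by omega) (by omega)
    exact ⟨v, hv, this ▸ ha⟩
  · rw [latticeGraph_adj_iff] at hab
    omega
  · rw [latticeGraph_adj_iff] at hvw
    omega
  · rw [latticeGraph_adj_iff] at hab hvw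
    by_cases hva : v = a
    · exact ⟨v, hv, hva ▸ ha⟩
    · have : v = b := by
        rw [Prod.ext_iff] at hva ⊢
        omega
      exact ⟨v, hv, this ▸ hb⟩

/-- The walk `subdivide l` with half an edge added at both ends, towards `p'` and `q'`. -/
def extendedSubdivision (p' p q q' : ℤ × ℤ) (l : List (ℤ × ℤ)) : List (ℤ × ℤ) :=
  (p' + p) :: (subdivide l ++ [q + q'])

theorem mem_extendedSubdivision {p' p q q' u : ℤ × ℤ} {l : List (ℤ × ℤ)} :
    u ∈ extendedSubdivision p' p q q' l ↔ u = p' + p ∨ u ∈ subdivide l ∨ u = q + q' := by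
  simp [extendedSubdivision]

theorem isChain_extendedSubdivision {p' p q q' : ℤ × ℤ} {l : List (ℤ × ℤ)}
    (h : l.IsChain latticeGraph.Adj) (hp : l.head? = some p) (hq : l.getLast? = some q)
    (hpp : latticeGraph.Adj p' p) (hqq : latticeGraph.Adj q q') :
    (extendedSubdivision p' p q q' l).IsChain latticeGraph.Adj := by
  rw [extendedSubdivision, List.isChain_cons, List.isChain_append]
  refine ⟨fun y hy => ?_, isChain_subdivide h, by simp, fun a ha b hb => ?_⟩
  · rw [List.head?_append, head?_subdivide hp] at hy
    simp only [Option.some_or, Option.mem_some_iff] at hy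
    rw [← hy]
    exact adj_midpoint_right hpp
  · rw [getLast?_subdivide hq] at ha
    simp only [Option.mem_some_iff, List.head?_cons] at ha hb
    rw [← ha, ← hb]
    exact adj_midpoint_left hqq

/-- The crossing lemma on the subdivided lattice: it is enough to control the two walks in the
columns of the midpoints of the edges `p'₁ p₁`, `p'₂ p₂`, `q₁ q'₁` and `q₂ q'₂`. -/
theorem exists_common_vertex {l₁ l₂ : List (ℤ × ℤ)} {p'₁ p₁ q₁ q'₁ p'₂ p₂ q₂ q'₂ : ℤ × ℤ}
    (h₁ : l₁.IsChain latticeGraph.Adj) (h₂ : l₂.IsChain latticeGraph.Adj)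
    (hp₁ : l₁.head? = some p₁) (hq₁ : l₁.getLast? = some q₁)
    (hp₂ : l₂.head? = some p₂) (hq₂ : l₂.getLast? = some q₂)
    (hpp₁ : latticeGraph.Adj p'₁ p₁) (hqq₁ : latticeGraph.Adj q₁ q'₁)
    (hpp₂ : latticeGraph.Adj p'₂ p₂) (hqq₂ : latticeGraph.Adj q₂ q'₂)
    (hpq : (p'₁ + p₁).1 ≤ (q₂ + q'₂).1) (hqp : (p'₂ + p₂).1 < (q₁ + q'₁).1)
    (hpl : ∀ v ∈ extendedSubdivision p'₂ p₂ q₂ q'₂ l₂,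
      v.1 = (p'₁ + p₁).1 → (p'₁ + p₁).2 < v.2)
    (hpl' : ∀ v ∈ extendedSubdivision p'₂ p₂ q₂ q'₂ l₂,
      v.1 = (q₁ + q'₁).1 → v.2 < (q₁ + q'₁).2)
    (hql : ∀ u ∈ extendedSubdivision p'₁ p₁ q₁ q'₁ l₁,
      u.1 = (p'₂ + p₂).1 → u.2 < (p'₂ + p₂).2)
    (hql' : ∀ u ∈ extendedSubdivision p'₁ p₁ q₁ q'₁ l₁,
      u.1 = (q₂ + q'₂).1 → (q₂ + q'₂).2 < u.2) :
    ∃ u ∈ l₁, u ∈ l₂ := by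
  obtain ⟨u, hu₁, hu₂⟩ := exists_common_vertex_of_ends
    (isChain_extendedSubdivision h₁ hp₁ hq₁ hpp₁ hqq₁)
    (isChain_extendedSubdivision h₂ hp₂ hq₂ hpp₂ hqq₂) rfl
    (by simp [extendedSubdivision, List.getLast?_cons]) rfl
    (by simp [extendedSubdivision, List.getLast?_cons]) hpq hqp hpl hpl' hql hql'
  refine exists_common_vertex_of_subdivide h₁ h₂ ⟨u, ?_, ?_⟩
  · rcases mem_extendedSubdivision.1 hu₁ with rfl | h | rfl
    · exact absurd (hpl _ hu₂ rfl) (lt_irrefl _)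
    · exact h
    · exact absurd (hpl' _ hu₂ rfl) (lt_irrefl _)
  · rcases mem_extendedSubdivision.1 hu₂ with rfl | h | rfl
    · exact absurd (hql _ hu₁ rfl) (lt_irrefl _)
    · exact h
    · exact absurd (hql' _ hu₁ rfl) (lt_irrefl _)

end Crossing

/-! ### Walks in a lattice region and in its translates -/

section Region

theorem LatticePath.XMonotone.fst_mem_Icc {p q : ℤ × ℤ} {w : LatticePath p q}
    (h : w.XMonotone) : ∀ v ∈ w.support, p.1 ≤ v.1 ∧ v.1 ≤ q.1 := by
  induction w with
  | nil => simp
  | @cons p u q huv w ih =>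
    have h1 : p.1 ≤ u.1 := h ⟨(p, u), huv⟩ (by simp)
    have h2 := ih fun e he => h e (by simp [he])
    have h3 := (h2 u (by simp)).2
    intro v hv
    rw [SimpleGraph.Walk.support_cons, List.mem_cons] at hv
    rcases hv with rfl | hv
    · exact ⟨le_rfl, h1.trans h3⟩
    · exact ⟨h1.trans (h2 v hv).1, (h2 v hv).2⟩

/-- A function of the steps may be summed over the darts or over the vertex list of a walk. -/
theorem countP_darts_eq_pairSum {p q : ℤ × ℤ} (w : LatticePath p q)
    (P : ℤ × ℤ → ℤ × ℤ → Prop) [∀ u v, Decidable (P u v)] :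
    w.darts.countP (fun e => decide (P e.fst e.snd)) =
      pairSum (fun u v => if P u v then 1 else 0) w.support := by
  induction w with
  | nil => simp [pairSum]
  | @cons p u q huv w ih =>
    rw [SimpleGraph.Walk.darts_cons, List.countP_cons, ih, SimpleGraph.Walk.support_cons]
    cases hw : w.support with
    | nil => simp at hw
    | cons a l =>
      have ha : a = u := by
        have := w.head_support
        simpa [hw] using this
      subst ha
      simp only [pairSum, decide_eq_true_eq]
      rw [add_comm]

theorem forall_mem_of_isChain {V : Type*} {r : V → V → Prop} {P : V → Prop}
    (hr : ∀ u v, r u v → P u) : ∀ {l : List V} {q : V}, l.IsChain r → l.getLast? = some q →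
      P q → ∀ v ∈ l, P v
  | [], _, _, h, _ => by simp at h
  | [w], q, _, h, hq => by
    simp only [List.getLast?_singleton, Option.some.injEq] at h
    simpa [h] using hq
  | w :: w' :: l, q, hc, h, hq => by
    rw [List.isChain_cons_cons] at hc
    rw [List.getLast?_cons_cons] at h
    have ih := forall_mem_of_isChain hr hc.2 h hq
    intro v hv
    rcases List.mem_cons.1 hv with rfl | hv
    · exact hr _ _ hc.1
    · exact ih v hv

namespace LatticeRegion

variable {m : ℕ} (Γ : LatticeRegion m)

/-- The unit edge from `v` to `w`, with its end points, lies in the region. -/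
def Step (v w : ℤ × ℤ) : Prop :=
  latticeGraph.Adj v w ∧ Γ.ContainsPoint v ∧ Γ.ContainsPoint w ∧
    ∀ i y : ℤ, s(((i, y) : ℤ × ℤ), ((i + 1, y) : ℤ × ℤ)) = s(v, w) → Γ.ContainsHorizontal i y

variable {Γ}

theorem ContainsPoint.fst_mem_Icc {v : ℤ × ℤ} (h : Γ.ContainsPoint v) : 0 ≤ v.1 ∧ v.1 ≤ m := by
  obtain ⟨y₁, y₂, -, -, h, -⟩ := h
  exact Γ.lower_mono.fst_mem_Icc (v.1, y₁) h

theorem containsPoint_of_mem_α {p : ℤ × ℤ} (h : p ∈ Γ.α) : Γ.ContainsPoint p := by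
  obtain ⟨x, y⟩ := p
  obtain ⟨rfl, h1, h2⟩ := h
  exact ⟨_, _, h1, h2, Γ.lower.start_mem_support, Γ.upper.start_mem_support⟩

theorem containsPoint_of_mem_β {p : ℤ × ℤ} (h : p ∈ Γ.β) : Γ.ContainsPoint p := by
  obtain ⟨x, y⟩ := p
  obtain ⟨rfl, h1, h2⟩ := h
  exact ⟨_, _, h1, h2, Γ.lower.end_mem_support, Γ.upper.end_mem_support⟩

theorem ContainsHorizontal.containsPoint {i y : ℤ} (h : Γ.ContainsHorizontal i y) :
    Γ.ContainsPoint (i, y) ∧ Γ.ContainsPoint (i + 1, y) := by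
  obtain ⟨y₁, y₂, h1, h2, h3, h4⟩ := h
  exact ⟨⟨y₁, y₂, h1, h2, SimpleGraph.Walk.fst_mem_support_of_mem_edges _ h3,
      SimpleGraph.Walk.fst_mem_support_of_mem_edges _ h4⟩,
    ⟨y₁, y₂, h1, h2, SimpleGraph.Walk.snd_mem_support_of_mem_edges _ h3,
      SimpleGraph.Walk.snd_mem_support_of_mem_edges _ h4⟩⟩

theorem step_vertical {v w : ℤ × ℤ} (h : latticeGraph.Adj v w) (hvw : v.1 = w.1) :
    Γ.Step v w ↔ Γ.ContainsPoint v ∧ Γ.ContainsPoint w := by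
  refine ⟨fun h => ⟨h.2.1, h.2.2.1⟩, fun k => ⟨h, k.1, k.2, fun i y e => ?_⟩⟩
  rw [Sym2.eq_iff] at e
  rcases e with ⟨rfl, rfl⟩ | ⟨rfl, rfl⟩ <;> simp at hvw

theorem step_horizontal {v w : ℤ × ℤ} (h : latticeGraph.Adj v w) (hvw : v.2 = w.2) :
    Γ.Step v w ↔ Γ.ContainsHorizontal (min v.1 w.1) v.2 := by
  have key : s(((min v.1 w.1, v.2) : ℤ × ℤ), ((min v.1 w.1 + 1, v.2) : ℤ × ℤ)) = s(v, w) := by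
    rw [latticeGraph_adj_iff] at h
    rw [Sym2.eq_iff]
    simp only [Prod.ext_iff, and_true]
    omega
  constructor
  · intro k
    exact k.2.2.2 _ _ key
  · intro k
    have hk := k.containsPoint
    have hmem : ∀ u ∈ s(v, w), Γ.ContainsPoint u := by
      rw [← key]
      intro u hu
      rcases Sym2.mem_iff.1 hu with rfl | rfl
      exacts [hk.1, hk.2]
    refine ⟨h, hmem v (by simp), hmem w (by simp), fun i y e => ?_⟩
    rw [← key, Sym2.eq_iff] at e
    simp only [Prod.ext_iff] at e
    obtain ⟨rfl, rfl⟩ : i = min v.1 w.1 ∧ y = v.2 := by omega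
    exact k

/-- Lying inside the region is a condition on consecutive vertices, up to the starting point, which
matters for the walk without steps. -/
theorem inside_iff {p q : ℤ × ℤ} (w : LatticePath p q) :
    Γ.Inside w ↔ Γ.ContainsPoint p ∧ w.support.IsChain Γ.Step := by
  induction w with
  | nil => simp [Inside, LatticePath.UsesHorizontal]
  | @cons p u q huv w ih =>
    have hs : w.support = u :: w.support.tail := (SimpleGraph.Walk.cons_tail_support w).symm
    have : (SimpleGraph.Walk.cons huv w).support.IsChain Γ.Step ↔
        Γ.Step p u ∧ w.support.IsChain Γ.Step := by
      rw [SimpleGraph.Walk.support_cons, hs, List.isChain_cons_cons]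
    rw [this]
    have e : Γ.Inside (SimpleGraph.Walk.cons huv w) ↔ Γ.ContainsPoint p ∧ Γ.Inside w ∧
        ∀ i y : ℤ, s(((i, y) : ℤ × ℤ), ((i + 1, y) : ℤ × ℤ)) = s(p, u) →
          Γ.ContainsHorizontal i y := by
      simp only [Inside, LatticePath.UsesHorizontal, SimpleGraph.Walk.support_cons,
        SimpleGraph.Walk.edges_cons, List.mem_cons, forall_eq, or_imp, forall_and]
      tauto
    rw [e, ih, Step]
    tauto

theorem exists_pathIn {p q : ℤ × ℤ} {l : List (ℤ × ℤ)} (hl : l.IsChain Γ.Step)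
    (hp : l.head? = some p) (hq : l.getLast? = some q) (h : Γ.ContainsPoint p) :
    ∃ w : Γ.PathIn p q, w.1.support = l := by
  have hne : l ≠ [] := by
    rintro rfl
    simp at hp
  obtain rfl : l.head hne = p := by
    rw [List.head?_eq_some_head hne] at hp
    exact Option.some.inj hp
  obtain rfl : l.getLast hne = q := by
    rw [List.getLast?_eq_some_getLast hne] at hq
    exact Option.some.inj hq
  have hs := SimpleGraph.Walk.support_ofSupport hne (hl.imp fun _ _ h => h.1)
  exact ⟨⟨_, (inside_iff _).2 ⟨h, by rwa [hs]⟩⟩, hs⟩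

/-- If an edge `p' p` of the region leaves the upward translate of the region, it leaves it
through the lower boundary, so that the translate lies above the midpoint of the edge in the
column of the midpoint. Coordinates are doubled in the conclusion. -/
theorem above_of_not_step {t : ℤ × ℤ} (ht : t.1 = 0) (ht' : 0 ≤ t.2) {p' p : ℤ × ℤ}
    (h : Γ.Step p' p) (hp : Γ.ContainsPoint (p - t)) (hn : ¬ Γ.Step (p' - t) (p - t)) :
    (∀ v, Γ.ContainsPoint (v - t) → (v + v).1 = (p' + p).1 → (p' + p).2 < (v + v).2) ∧
      ∀ v w, Γ.Step (v - t) (w - t) → (v + w).1 = (p' + p).1 → (p' + p).2 < (v + w).2 := by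
  have hadj := latticeGraph_adj_iff.1 h.1
  have hadjt : latticeGraph.Adj (p' - t) (p - t) := by
    rw [latticeGraph_adj_iff]
    simp only [Prod.fst_sub, Prod.snd_sub]
    omega
  rcases hadj with ⟨e, e'⟩ | ⟨e, e'⟩
  · rw [step_vertical hadjt (by simp [e])] at hn
    -- `p' - t` is below the upper boundary as `p'` is, so it must be below the lower boundary.
    have key : ∀ v, Γ.ContainsPoint (v - t) → v.1 = p.1 → p'.2 < v.2 := by
      rintro v ⟨y₁, y₂, h1, h2, h3, h4⟩ hv
      by_contra! hlt
      obtain ⟨z₁, z₂, k1, k2, k3, k4⟩ := h.2.1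
      refine hn ⟨⟨y₁, z₂, ?_, ?_, ?_, ?_⟩, hp⟩
      · simp only [Prod.snd_sub] at h1 ⊢
        omega
      · simp only [Prod.snd_sub]
        omega
      · simpa [← e, hv] using h3
      · simpa [ht] using k4
    have kp := key p hp rfl
    simp only [Prod.fst_add, Prod.snd_add]
    constructor
    · intro v hv hv1
      have := key v hv (by omega)
      omega
    · intro v w hvw hv1
      have ha := latticeGraph_adj_iff.1 hvw.1
      simp only [Prod.fst_sub, Prod.snd_sub] at ha
      have a1 := key v hvw.2.1 (by omega)
      have a2 := key w hvw.2.2.1 (by omega)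
      omega
  · rw [step_horizontal hadjt (by simp [e])] at hn
    rw [step_horizontal h.1 e.symm] at h
    simp only [Prod.fst_add, Prod.snd_add]
    constructor
    · intro v hv hv1
      omega
    · intro v w hvw hv1
      have ha := latticeGraph_adj_iff.1 hvw.1
      simp only [Prod.fst_sub, Prod.snd_sub] at ha
      rw [step_horizontal hvw.1 (by simp only [Prod.snd_sub]; omega)] at hvw
      obtain ⟨y₁, y₂, h1, h2, h3, h4⟩ := hvw
      by_contra! hlt
      obtain ⟨z₁, z₂, k1, k2, k3, k4⟩ := h
      refine hn ⟨y₁, z₂, ?_, ?_, ?_, ?_⟩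
      · simp only [Prod.snd_sub] at h1 ⊢
        omega
      · simp only [Prod.snd_sub]
        omega
      · convert h3 using 1
        simp only [Prod.fst_sub]
        omega
      · convert k4 using 1
        simp only [Prod.fst_sub]
        omega

/-- If an edge `q' q` of the upward translate of the region leaves the region, it leaves it
through the upper boundary, so that the region lies below the midpoint of the edge in the
column of the midpoint. Coordinates are doubled in the conclusion. -/
theorem below_of_not_step {t : ℤ × ℤ} (ht : t.1 = 0) (ht' : 0 ≤ t.2) {q' q : ℤ × ℤ}
    (h : Γ.Step (q' - t) (q - t)) (hq : Γ.ContainsPoint q) (hn : ¬ Γ.Step q' q) :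
    (∀ v, Γ.ContainsPoint v → (v + v).1 = (q' + q).1 → (v + v).2 < (q' + q).2) ∧
      ∀ v w, Γ.Step v w → (v + w).1 = (q' + q).1 → (v + w).2 < (q' + q).2 := by
  have hadj : latticeGraph.Adj q' q := by
    have := latticeGraph_adj_iff.1 h.1
    rw [latticeGraph_adj_iff]
    simp only [Prod.fst_sub, Prod.snd_sub] at this
    omega
  rcases latticeGraph_adj_iff.1 hadj with ⟨e, e'⟩ | ⟨e, e'⟩
  · rw [step_vertical hadj e.symm] at hn
    -- `q'` is above the lower boundary as `q' - t` is, so it must be above the upper boundary.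
    have key : ∀ v, Γ.ContainsPoint v → v.1 = q.1 → v.2 < q'.2 := by
      rintro v ⟨y₁, y₂, h1, h2, h3, h4⟩ hv
      by_contra! hlt
      obtain ⟨z₁, z₂, k1, k2, k3, k4⟩ := h.2.1
      refine hn ⟨⟨z₁, y₂, ?_, ?_, ?_, ?_⟩, hq⟩
      · simp only [Prod.snd_sub] at k1
        omega
      · omega
      · simpa [ht] using k3
      · simpa [← e, hv] using h4
    have kq := key q hq rfl
    simp only [Prod.fst_add, Prod.snd_add]
    constructor
    · intro v hv hv1
      have := key v hv (by omega)
      omega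
    · intro v w hvw hv1
      have ha := latticeGraph_adj_iff.1 hvw.1
      have a1 := key v hvw.2.1 (by omega)
      have a2 := key w hvw.2.2.1 (by omega)
      omega
  · rw [step_horizontal hadj e.symm] at hn
    rw [step_horizontal h.1 (by simp [e])] at h
    simp only [Prod.fst_add, Prod.snd_add]
    constructor
    · intro v hv hv1
      omega
    · intro v w hvw hv1
      have ha := latticeGraph_adj_iff.1 hvw.1
      rw [step_horizontal hvw.1 (by omega)] at hvw
      obtain ⟨y₁, y₂, h1, h2, h3, h4⟩ := hvw
      by_contra! hlt
      obtain ⟨z₁, z₂, k1, k2, k3, k4⟩ := h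
      refine hn ⟨z₁, y₂, ?_, ?_, ?_, ?_⟩
      · simp only [Prod.snd_sub] at k1
        omega
      · omega
      · convert k3 using 1
        simp only [Prod.fst_sub]
        omega
      · convert h4 using 1
        omega

variable (Γ) in
/-- The unit edge from `v` to `w` lies in the region and in its translate by `t`. -/
def CommonStep (t v w : ℤ × ℤ) : Prop :=
  Γ.Step v w ∧ Γ.Step (v - t) (w - t)

/-- The vertex preceding the maximal tail `T` of the walk `K ++ T`, with a vertex to the left of
the strip as a replacement if there is none. -/
theorem exists_predecessor {r s : ℤ × ℤ → ℤ × ℤ → Prop} {K T : List (ℤ × ℤ)} {a : ℤ}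
    {p : ℤ × ℤ} (hc : (K ++ T).IsChain s) (hh : (K ++ T).head? = some (0, a))
    (hT : T.head? = some p) (hmax : ∀ g ∈ K.getLast?, ∀ h ∈ T.head?, ¬ r g h) :
    ∃ p', (p' = (-1, a) ∧ p = (0, a)) ∨ (s p' p ∧ ¬ r p' p) := by
  rcases List.eq_nil_or_concat' K with rfl | ⟨K, k, rfl⟩
  · rw [List.nil_append, hT] at hh
    exact ⟨_, Or.inl ⟨rfl, Option.some.inj hh⟩⟩
  · exact ⟨k, Or.inr ⟨(List.isChain_append.1 hc).2.2 k (by simp) p hT, hmax k (by simp) p hT⟩⟩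

/-- The crossing: the loop erasure of the maximal common tail of a walk in the region meets the
maximal common tail of a walk in the translate, if the first walk starts not above and ends above
the second one. -/
theorem exists_mem_loopErase {t : ℤ × ℤ} (ht : t.1 = 0) (ht' : 0 ≤ t.2) {a b c c' : ℤ}
    (hab : a ≤ b) (hc : c' < c) {K₁ T₁ K₂ T₂ : List (ℤ × ℤ)}
    (h₁ : (K₁ ++ T₁).IsChain Γ.Step)
    (h₂ : (K₂ ++ T₂).IsChain fun v w => Γ.Step (v - t) (w - t))
    (hh₁ : (K₁ ++ T₁).head? = some (0, a)) (hh₂ : (K₂ ++ T₂).head? = some (0, b))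
    (hl₁ : T₁.getLast? = some ((m : ℤ), c)) (hl₂ : T₂.getLast? = some ((m : ℤ), c'))
    (hC : Γ.ContainsPoint ((m : ℤ), c)) (hCt : Γ.ContainsPoint (((m : ℤ), c) - t))
    (hC' : Γ.ContainsPoint ((m : ℤ), c')) (hCt' : Γ.ContainsPoint (((m : ℤ), c') - t))
    (hT₁ : T₁.IsChain (Γ.CommonStep t)) (hT₂ : T₂.IsChain (Γ.CommonStep t))
    (hm₁ : ∀ g ∈ K₁.getLast?, ∀ h ∈ T₁.head?, ¬ Γ.CommonStep t g h)
    (hm₂ : ∀ g ∈ K₂.getLast?, ∀ h ∈ T₂.head?, ¬ Γ.CommonStep t g h) :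
    ∃ x ∈ loopErase T₁, x ∈ T₂ := by
  obtain ⟨p₁, hp₁⟩ : ∃ p, T₁.head? = some p := by
    cases T₁ with
    | nil => simp at hl₁
    | cons p T => exact ⟨p, rfl⟩
  obtain ⟨p₂, hp₂⟩ : ∃ p, T₂.head? = some p := by
    cases T₂ with
    | nil => simp at hl₂
    | cons p T => exact ⟨p, rfl⟩
  have hq₁ := getLast?_loopErase T₁
  rw [hl₁] at hq₁
  have hP₁ := head?_loopErase T₁
  rw [hp₁] at hP₁
  -- If `a = b` and both tails are whole walks, then they start at the same vertex.
  by_cases hpp : p₁ = p₂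
  · exact ⟨p₁, List.mem_of_mem_head? hP₁, hpp ▸ List.mem_of_mem_head? hp₂⟩
  have hE := isChain_loopErase T₁ hT₁
  have hpt : ∀ u v, Γ.CommonStep t u v → Γ.ContainsPoint u ∧ Γ.ContainsPoint (u - t) :=
    fun u v h => ⟨h.1.2.1, h.2.2.1⟩
  have hin₁ := forall_mem_of_isChain hpt hE hq₁ ⟨hC, hCt⟩
  have hin₂ := forall_mem_of_isChain hpt hT₂ hl₂ ⟨hC', hCt'⟩
  have hip₁ := hin₁ p₁ (List.mem_of_mem_head? hP₁)
  have hip₂ := hin₂ p₂ (List.mem_of_mem_head? hp₂)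
  obtain ⟨p'₁, hp'₁⟩ := exists_predecessor h₁ hh₁ hp₁ hm₁
  obtain ⟨p'₂, hp'₂⟩ := exists_predecessor h₂ hh₂ hp₂ hm₂
  have hadj₁ : latticeGraph.Adj p'₁ p₁ := by
    rcases hp'₁ with ⟨rfl, rfl⟩ | h
    · simp [latticeGraph_adj_iff]
    · exact h.1.1
  have hadj₂ : latticeGraph.Adj p'₂ p₂ := by
    rcases hp'₂ with ⟨rfl, rfl⟩ | h
    · simp [latticeGraph_adj_iff]
    · have := latticeGraph_adj_iff.1 h.1.1
      rw [latticeGraph_adj_iff]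
      simp only [Prod.fst_sub, Prod.snd_sub] at this
      omega
  -- The half edge preceding a tail lies in column `-1` of the refined lattice if the tail is the
  -- whole walk; otherwise its edge leaves the region or its translate.
  have hcol₁ : ((p'₁ + p₁).1 = -1 ∧ (p'₁ + p₁).2 = 2 * a) ∨
      (0 ≤ (p'₁ + p₁).1 ∧ (p'₁ + p₁).1 ≤ 2 * m ∧ Γ.Step p'₁ p₁ ∧
        ¬ Γ.Step (p'₁ - t) (p₁ - t)) := by
    rcases hp'₁ with ⟨rfl, rfl⟩ | h
    · left
      simp
      omega
    · right
      have b1 := h.1.2.1.fst_mem_Icc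
      have b2 := h.1.2.2.1.fst_mem_Icc
      refine ⟨?_, ?_, h.1, fun k => h.2 ⟨h.1, k⟩⟩ <;> simp only [Prod.fst_add] <;> omega
  have hcol₂ : ((p'₂ + p₂).1 = -1 ∧ (p'₂ + p₂).2 = 2 * b) ∨
      (0 ≤ (p'₂ + p₂).1 ∧ (p'₂ + p₂).1 ≤ 2 * m ∧ Γ.Step (p'₂ - t) (p₂ - t) ∧
        ¬ Γ.Step p'₂ p₂) := by
    rcases hp'₂ with ⟨rfl, rfl⟩ | h
    · left
      simp
      omega
    · right
      have b1 := h.1.2.1.fst_mem_Icc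
      have b2 := h.1.2.2.1.fst_mem_Icc
      simp only [Prod.fst_sub] at b1 b2
      refine ⟨?_, ?_, h.1, fun k => h.2 ⟨k, h.1⟩⟩ <;> simp only [Prod.fst_add] <;> omega
  have hab' : (p'₁ + p₁).1 = -1 → (p'₂ + p₂).1 = -1 → a < b := by
    intro e₁ e₂
    rcases hp'₁ with ⟨rfl, rfl⟩ | h
    · rcases hp'₂ with ⟨rfl, rfl⟩ | h
      · refine lt_of_le_of_ne hab fun h => hpp (by rw [h])
      · have b := h.1.2.1.fst_mem_Icc
        have b' := h.1.2.2.1.fst_mem_Icc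
        simp only [Prod.fst_sub, Prod.fst_add] at b b' e₂
        omega
    · have b := h.1.2.1.fst_mem_Icc
      have b' := h.1.2.2.1.fst_mem_Icc
      simp only [Prod.fst_add] at e₁
      omega
  have hsub₁ : ∀ u ∈ subdivide (loopErase T₁), 0 ≤ u.1 ∧ u.1 ≤ 2 * m ∧
      ((∃ v, u = v + v ∧ Γ.ContainsPoint v) ∨ ∃ v w, u = v + w ∧ Γ.Step v w) := by
    intro u hu
    rcases mem_subdivide hE hu with ⟨v, hv, rfl⟩ | ⟨v, hv, w, hw, hvw, rfl⟩
    · have b1 := (hin₁ v hv).1.fst_mem_Icc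
      refine ⟨?_, ?_, Or.inl ⟨v, rfl, (hin₁ v hv).1⟩⟩ <;> simp only [Prod.fst_add] <;> omega
    · have b1 := (hin₁ v hv).1.fst_mem_Icc
      have b2 := (hin₁ w hw).1.fst_mem_Icc
      refine ⟨?_, ?_, Or.inr ⟨v, w, rfl, hvw.1⟩⟩ <;> simp only [Prod.fst_add] <;> omega
  have hsub₂ : ∀ u ∈ subdivide T₂, 0 ≤ u.1 ∧ u.1 ≤ 2 * m ∧
      ((∃ v, u = v + v ∧ Γ.ContainsPoint (v - t)) ∨
        ∃ v w, u = v + w ∧ Γ.Step (v - t) (w - t)) := by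
    intro u hu
    rcases mem_subdivide hT₂ hu with ⟨v, hv, rfl⟩ | ⟨v, hv, w, hw, hvw, rfl⟩
    · have b1 := (hin₂ v hv).1.fst_mem_Icc
      refine ⟨?_, ?_, Or.inl ⟨v, rfl, (hin₂ v hv).2⟩⟩ <;> simp only [Prod.fst_add] <;> omega
    · have b1 := (hin₂ v hv).1.fst_mem_Icc
      have b2 := (hin₂ w hw).1.fst_mem_Icc
      refine ⟨?_, ?_, Or.inr ⟨v, w, rfl, hvw.2⟩⟩ <;> simp only [Prod.fst_add] <;> omega
  have hm0 : (0 : ℤ) ≤ m := Int.natCast_nonneg m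
  -- To the right of the strip, the walks are prolonged by half an edge into column `2 * m + 1`.
  refine exists_common_vertex (p'₁ := p'₁) (q'₁ := ((m : ℤ) + 1, c)) (p'₂ := p'₂)
    (q'₂ := ((m : ℤ) + 1, c')) (hE.imp fun _ _ h => h.1.1) (hT₂.imp fun _ _ h => h.1.1)
    hP₁ hq₁ hp₂ hl₂ hadj₁ (by simp [latticeGraph_adj_iff]) hadj₂
    (by simp [latticeGraph_adj_iff]) ?_ ?_ ?_ ?_ ?_ ?_
  · change _ ≤ (m : ℤ) + (m + 1)
    omega
  · change _ < (m : ℤ) + (m + 1)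
    omega
  · intro u hu e
    rcases mem_extendedSubdivision.1 hu with rfl | hu | rfl
    · rcases hcol₁ with h | ⟨h1, h2, h3, h4⟩
      · have := hab' h.1 (e.trans h.1)
        omega
      · rcases hcol₂ with k | ⟨k1, k2, k3, k4⟩
        · omega
        · exact (above_of_not_step ht ht' h3 hip₁.2 h4).2 _ _ k3 e
    · obtain ⟨b1, b2, hor⟩ := hsub₂ u hu
      rcases hcol₁ with h | ⟨h1, h2, h3, h4⟩
      · omega
      · have key := above_of_not_step ht ht' h3 hip₁.2 h4
        rcases hor with ⟨v, rfl, hv⟩ | ⟨v, w, rfl, hvw⟩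
        · exact key.1 v hv e
        · exact key.2 v w hvw e
    · change (m : ℤ) + (m + 1) = _ at e
      omega
  · intro u hu e
    change u.1 = (m : ℤ) + (m + 1) at e
    change u.2 < c + c
    rcases mem_extendedSubdivision.1 hu with rfl | hu | rfl
    · omega
    · have := hsub₂ u hu
      omega
    · change c' + c' < c + c
      omega
  · intro u hu e
    rcases mem_extendedSubdivision.1 hu with rfl | hu | rfl
    · rcases hcol₂ with h | ⟨h1, h2, h3, h4⟩
      · have := hab' (e.trans h.1) h.1
        omega
      · rcases hcol₁ with k | ⟨k1, k2, k3, k4⟩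
        · omega
        · exact (below_of_not_step ht ht' h3 hip₂.1 h4).2 _ _ k3 e
    · obtain ⟨b1, b2, hor⟩ := hsub₁ u hu
      rcases hcol₂ with h | ⟨h1, h2, h3, h4⟩
      · omega
      · have key := below_of_not_step ht ht' h3 hip₂.1 h4
        rcases hor with ⟨v, rfl, hv⟩ | ⟨v, w, rfl, hvw⟩
        · exact key.1 v hv e
        · exact key.2 v w hvw e
    · change (m : ℤ) + (m + 1) = _ at e
      omega
  · intro u hu e
    change u.1 = (m : ℤ) + (m + 1) at e
    change c' + c' < u.2
    rcases mem_extendedSubdivision.1 hu with rfl | hu | rfl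
    · omega
    · have := hsub₁ u hu
      omega
    · change c' + c' < c + c
      omega

end LatticeRegion

end Region

/-! ### The injection -/

section Injection

theorem LatticePath.head?_support {p q : ℤ × ℤ} (w : LatticePath p q) :
    w.support.head? = some p := by
  rw [List.head?_eq_some_head w.support_ne_nil, w.head_support]

theorem LatticePath.getLast?_support {p q : ℤ × ℤ} (w : LatticePath p q) :
    w.support.getLast? = some q := by
  rw [List.getLast?_eq_some_getLast w.support_ne_nil, w.getLast_support]

/-- The swap, carried out after translating the second path by `t`. -/
theorem LatticeRegion.exists_tailSwap {m : ℕ} {Γ : LatticeRegion m} {a b c d c' d' s : ℤ}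
    (hs : 0 ≤ s) (hab : a ≤ b + s) (hc : c' < c) (hcd' : c' = d + s) (hdc : c = d' + s)
    (hA : Γ.ContainsPoint (0, a)) (hB : Γ.ContainsPoint (0, b))
    (hC : Γ.ContainsPoint ((m : ℤ), c)) (hC' : Γ.ContainsPoint ((m : ℤ), c'))
    (hD' : Γ.ContainsPoint ((m : ℤ), d')) (hD : Γ.ContainsPoint ((m : ℤ), d))
    (ξ : Γ.PathIn (0, a) ((m : ℤ), c)) (ζ : Γ.PathIn (0, b) ((m : ℤ), d)) :
    ∃ (ξ' : Γ.PathIn (0, a) ((m : ℤ), c')) (ζ' : Γ.PathIn (0, b) ((m : ℤ), d')),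
      TailSwap (Γ.CommonStep (0, s)) ξ.1.support (ζ.1.support.map (· + (0, s)))
        ξ'.1.support (ζ'.1.support.map (· + (0, s))) := by
  obtain ⟨K₁, T₁, e₁, hne₁, hT₁, hm₁⟩ :=
    exists_maximal_tail (Γ.CommonStep (0, s)) ξ.1.support ξ.1.support_ne_nil
  obtain ⟨K₂, T₂, e₂, hne₂, hT₂, hm₂⟩ :=
    exists_maximal_tail (Γ.CommonStep (0, s)) (ζ.1.support.map (· + (0, s)))
      (by simp)
  have hξ := ((LatticeRegion.inside_iff _).1 ξ.2).2
  have hζ : (ζ.1.support.map (· + (0, s))).IsChain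
      fun v w => Γ.Step (v - (0, s)) (w - (0, s)) := by
    rw [List.isChain_map]
    simpa only [add_sub_cancel_right] using ((LatticeRegion.inside_iff _).1 ζ.2).2
  have hζh : (ζ.1.support.map (· + (0, s))).head? = some (0, b + s) := by
    rw [List.head?_map, LatticePath.head?_support]
    simp
  have hζl : (ζ.1.support.map (· + (0, s))).getLast? = some ((m : ℤ), c') := by
    rw [List.getLast?_map, LatticePath.getLast?_support, hcd']
    simp
  have hx := LatticeRegion.exists_mem_loopErase (t := (0, s)) rfl hs hab hc (e₁ ▸ hξ)
    (e₂ ▸ hζ) (e₁ ▸ LatticePath.head?_support _) (e₂ ▸ hζh)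
    (by rw [← LatticePath.getLast?_support ξ.1, e₁, List.getLast?_append_of_ne_nil _ hne₁])
    (by rw [← hζl, e₂, List.getLast?_append_of_ne_nil _ hne₂]) hC
    (by simpa [hdc] using hD') hC' (by simpa [hcd'] using hD) hT₁ hT₂ hm₁ hm₂
  obtain ⟨l₁, l₂, h⟩ := _root_.exists_tailSwap hT₁ hT₂ hm₁ hm₂ hx
  rw [← e₁, ← e₂] at h
  obtain ⟨g1, g2, g3, g4⟩ := h.ends
  obtain ⟨ξ', hξ'⟩ := LatticeRegion.exists_pathIn (h.isChain_left (fun _ _ h => h.1) hξ)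
    (g1.trans (LatticePath.head?_support _)) (g3.trans hζl) hA
  have hl₂ : ((l₂.map (· - (0, s))).map (· + (0, s))) = l₂ := by
    simp [List.map_map, Function.comp_def]
  obtain ⟨ζ', hζ'⟩ := LatticeRegion.exists_pathIn (Γ := Γ) (l := l₂.map (· - (0, s)))
    (p := (0, b)) (q := ((m : ℤ), d'))
    (by
      rw [List.isChain_map]
      exact h.isChain_right (fun _ _ h => h.2) hζ)
    (by rw [List.head?_map, g2, hζh]; simp)
    (by rw [List.getLast?_map, g4, LatticePath.getLast?_support, hdc]; simp) hB
  exact ⟨ξ', ζ', by rwa [hξ', hζ', hl₂]⟩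

/-- A tail swap does not change the total number of steps of a translation invariant kind. -/
theorem TailSwap.countP_darts_add {r : ℤ × ℤ → ℤ × ℤ → Prop} {t : ℤ × ℤ}
    {p₁ q₁ p₂ q₂ p'₁ q'₁ p'₂ q'₂ : ℤ × ℤ} {w₁ : LatticePath p₁ q₁} {w₂ : LatticePath p₂ q₂}
    {w'₁ : LatticePath p'₁ q'₁} {w'₂ : LatticePath p'₂ q'₂}
    (h : TailSwap r w₁.support (w₂.support.map (· + t)) w'₁.support (w'₂.support.map (· + t)))
    (P : ℤ × ℤ → ℤ × ℤ → Prop) [∀ u v, Decidable (P u v)]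
    (hP : ∀ u v, P (u + t) (v + t) ↔ P u v) :
    w₁.darts.countP (fun e => decide (P e.fst e.snd)) +
        w₂.darts.countP (fun e => decide (P e.fst e.snd)) =
      w'₁.darts.countP (fun e => decide (P e.fst e.snd)) +
        w'₂.darts.countP (fun e => decide (P e.fst e.snd)) := by
  have := h.pairSum_add fun u v => if P u v then 1 else 0
  simp only [pairSum_map, hP] at this
  simpa only [countP_darts_eq_pairSum _ P] using this

end Injection

theorem lemma2p1 (m : ℕ) (hm : 0 < m) (Γ : LatticeRegion m) (a b c d r : ℤ)
    (hA : ((0 : ℤ), a) ∈ Γ.α) (hB : ((0 : ℤ), b) ∈ Γ.α)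
    (hC : ((m : ℤ), c) ∈ Γ.β) (hC' : ((m : ℤ), c - r) ∈ Γ.β)
    (hD' : ((m : ℤ), d + r) ∈ Γ.β) (hD : ((m : ℤ), d) ∈ Γ.β)
    (hr : 0 < r) (hdc : d ≤ c - r) (hab : a - b ≤ (c - d) - r) :
    ∃ Φ : Γ.PathIn ((0 : ℤ), a) ((m : ℤ), c) × Γ.PathIn ((0 : ℤ), b) ((m : ℤ), d) →
          Γ.PathIn ((0 : ℤ), a) ((m : ℤ), c - r) × Γ.PathIn ((0 : ℤ), b) ((m : ℤ), d + r),
      Function.Injective Φ ∧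
      ∀ ξ : Γ.PathIn ((0 : ℤ), a) ((m : ℤ), c) × Γ.PathIn ((0 : ℤ), b) ((m : ℤ), d),
        (∀ i : ℤ, 0 ≤ i → i ≤ (m : ℤ) - 1 →
          LatticePath.horizontalCount ξ.1.1 i + LatticePath.horizontalCount ξ.2.1 i =
            LatticePath.horizontalCount (Φ ξ).1.1 i +
              LatticePath.horizontalCount (Φ ξ).2.1 i) ∧
        (∀ j : ℤ, 0 ≤ j → j ≤ (m : ℤ) →
          LatticePath.verticalCount ξ.1.1 j + LatticePath.verticalCount ξ.2.1 j =
            LatticePath.verticalCount (Φ ξ).1.1 j +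
              LatticePath.verticalCount (Φ ξ).2.1 j) := by
  have key : ∀ ξ : Γ.PathIn ((0 : ℤ), a) ((m : ℤ), c) × Γ.PathIn ((0 : ℤ), b) ((m : ℤ), d),
      ∃ η : Γ.PathIn ((0 : ℤ), a) ((m : ℤ), c - r) × Γ.PathIn ((0 : ℤ), b) ((m : ℤ), d + r),
        TailSwap (Γ.CommonStep (0, c - d - r)) ξ.1.1.support
          (ξ.2.1.support.map (· + (0, c - d - r))) η.1.1.support
          (η.2.1.support.map (· + (0, c - d - r))) := by
    intro ξ
    obtain ⟨ξ', ζ', h⟩ := LatticeRegion.exists_tailSwap (s := c - d - r) (by omega) (by omega)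
      (by omega) (by omega) (by omega) (LatticeRegion.containsPoint_of_mem_α hA)
      (LatticeRegion.containsPoint_of_mem_α hB) (LatticeRegion.containsPoint_of_mem_β hC)
      (LatticeRegion.containsPoint_of_mem_β hC') (LatticeRegion.containsPoint_of_mem_β hD')
      (LatticeRegion.containsPoint_of_mem_β hD) ξ.1 ξ.2
    exact ⟨(ξ', ζ'), h⟩
  choose Φ hΦ using key
  refine ⟨Φ, fun ξ ζ e => ?_, fun ξ => ⟨fun i _ _ => ?_, fun j _ _ => ?_⟩⟩
  · have hζ := hΦ ζ
    rw [← e] at hζ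
    obtain ⟨h1, h2⟩ := (hΦ ξ).injective hζ
    exact Prod.ext (Subtype.ext (SimpleGraph.Walk.ext_support h1))
      (Subtype.ext (SimpleGraph.Walk.ext_support
        (List.map_injective_iff.2 (add_left_injective _) h2)))
  · exact (hΦ ξ).countP_darts_add
      (fun u v => (u.1 = i ∧ v.1 = i + 1) ∨ (u.1 = i + 1 ∧ v.1 = i)) (by simp)
  · exact (hΦ ξ).countP_darts_add (fun u v => u.1 = j ∧ v.1 = j) (by simp)
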